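/- Let $R$ be a nonzero commutative ring with $1$ and let $k\in\mathbb N=\{0,1,2,\dots\}$. A $k$-graph is a countable category $\Lambda$ (with source and range maps $s,r$) together with a functor $d:\Lambda\to\mathbb N^k$ such that whenever $d(\lambda)=m+n$ there are unique $\mu,\nu\in\Lambda$ with $d(\mu)=m$, $d(\nu)=n$ and $\lambda=\mu\nu$. Its set of objects (vertices), identified with $d^{-1}(0)$, is denoted $\Lambda^0$; write $\Lambda^{\neq 0}=\{\lambda\in\Lambda : d(\lambda)\neq 0\}$ and $v\Lambda^n=\{\lambda\in\Lambda : r(\lambda)=v,\ d(\lambda)=n\}$. Assume that $\Lambda$ is row-finite and has no sources, i.e. each $v\Lambda^n$ ($v\in\Lambda^0$, $n\in\mathbb N^k$) is finite and nonempty. The Kumjian–Pask algebra $\mathrm{KP}_R(\Lambda)$ is the associative (not necessarily unital) $R$-algebra generated by symbols $p_v$ ($v\in\Lambda^0$) and $s_\lambda, s_{\lambda^*}$ ($\lambda\in\Lambda^{\neq 0}$) subject to the relations 1. $p_vp_w=\delta_{v,w}p_v$ for $v,w\in\Lambda^0$; 2. $s_\lambda s_\mu=s_{\lambda\mu}$ and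 $s_{\mu^*}s_{\lambda^*}=s_{(\lambda\mu)^*}$ for $\lambda,\mu\in\Lambda^{\neq 0}$ with $r(\mu)=s(\lambda)$; and $p_{r(\lambda)}s_\lambda=s_\lambda=s_\lambda p_{s(\lambda)}$ and $p_{s(\lambda)}s_{\lambda^*}=s_{\lambda^*}=s_{\lambda^*}p_{r(\lambda)}$ for $\lambda\in\Lambda^{\neq 0}$; 3. $s_{\lambda^*}s_\mu=\delta_{\lambda,\mu}p_{s(\lambda)}$ for $\lambda,\mu\in\Lambda^{\neq 0}$ with $d(\lambda)=d(\mu)$; 4. $p_v=\sum_{\lambda\in v\Lambda^n}s_\lambda s_{\lambda^*}$ for $v\in\Lambda^0$ and $n\in\mathbb N^k\setminus\{0\}$. Then $\mathrm{KP}_R(\Lambda)$ has a multiplicative identity if and only if $\Lambda^0$ is finite. -/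

import Mathlib

open CategoryTheory

universe v u w x

/-- A `k`-graph structure on a category `Λ`: the category is countable and carries a degree functor
to the monoid `ℕ^k` with the unique factorization property.  The objects of `Λ` are the vertices.
A morphism `l : a ⟶ b` is a path with source `a` and range `b`, and the composite path written
`λμ` (first `μ`, then `λ`) is `μ ≫ λ`. -/
structure KGraph (k : ℕ) (Λ : Type u) [Category.{v} Λ] where
  /-- The degree of a path. -/
  deg : ∀ {a b : Λ}, (a ⟶ b) → (Fin k → ℕ)
  deg_id : ∀ a : Λ, deg (𝟙 a) = 0
  deg_comp : ∀ {a b c : Λ} (m : a ⟶ b) (l : b ⟶ c), deg (m ≫ l) = deg l + deg m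
  factorization : ∀ {a c : Λ} (l : a ⟶ c) (m n : Fin k → ℕ), deg l = m + n →
    ∃! p : Σ b : Λ, (b ⟶ c) × (a ⟶ b),
      deg p.2.1 = m ∧ deg p.2.2 = n ∧ p.2.2 ≫ p.2.1 = l
  countable_vertices : Countable Λ
  countable_hom : ∀ a b : Λ, Countable (a ⟶ b)

namespace KGraph

variable {k : ℕ} {Λ : Type u} [Category.{v} Λ]

/-- The set `vΛ^n`, as a type: the paths of degree `n` with range `b`. -/
def RowPath (G : KGraph k Λ) (b : Λ) (n : Fin k → ℕ) : Type (max u v) :=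
  {p : Σ a : Λ, (a ⟶ b) // G.deg p.2 = n}

/-- `vΛ^n` is finite for all vertices `v` and all `n`. -/
def RowFinite (G : KGraph k Λ) : Prop :=
  ∀ (b : Λ) (n : Fin k → ℕ), Finite (G.RowPath b n)

/-- `vΛ^n` is nonempty for all vertices `v` and all `n`. -/
def NoSources (G : KGraph k Λ) : Prop :=
  ∀ (b : Λ) (n : Fin k → ℕ), Nonempty (G.RowPath b n)

/-- The paths of nonzero degree. -/
structure PosPath (G : KGraph k Λ) where
  /-- The source. -/
  s : Λ
  /-- The range. -/
  r : Λ
  /-- The underlying morphism. -/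
  hom : s ⟶ r
  deg_ne_zero : G.deg hom ≠ 0

namespace PosPath

variable {G : KGraph k Λ}

/-- The degree of a path of nonzero degree. -/
def d (p : G.PosPath) : Fin k → ℕ := G.deg p.hom

/-- The composite `pq` of two paths of nonzero degree with `r(q) = s(p)`. -/
def comp (p q : G.PosPath) (h : q.r = p.s) : G.PosPath where
  s := q.s
  r := p.r
  hom := q.hom ≫ eqToHom h ≫ p.hom
  deg_ne_zero := by
    obtain ⟨a, b, l, hl⟩ := p
    obtain ⟨a', b', m, hm⟩ := q
    dsimp only at h
    subst h
    simp only [eqToHom_refl, Category.id_comp, G.deg_comp]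
    intro h0
    apply hl
    funext i
    have := congrFun h0 i
    simp only [Pi.add_apply, Pi.zero_apply] at this ⊢
    omega

end PosPath

end KGraph

section Family

variable {k : ℕ} {Λ : Type u} [Category.{v} Λ]

open scoped Classical in
/-- A Kumjian–Pask family in a (not necessarily unital) ring `A`: `P v` for vertices `v`, `S p`
for paths `p` of nonzero degree, and `T p` for the ghost path `p^*` of such a path `p`. -/
structure IsKumjianPaskFamily (G : KGraph k Λ) {A : Type x} [NonUnitalRing A]
    (P : Λ → A) (S T : G.PosPath → A) : Prop where
  kp1 : ∀ a b : Λ, P a * P b = if a = b then P a else 0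
  kp2_path : ∀ (p q : G.PosPath) (h : q.r = p.s), S p * S q = S (p.comp q h)
  kp2_ghost : ∀ (p q : G.PosPath) (h : q.r = p.s), T q * T p = T (p.comp q h)
  kp2_range_path : ∀ p : G.PosPath, P p.r * S p = S p
  kp2_path_source : ∀ p : G.PosPath, S p * P p.s = S p
  kp2_source_ghost : ∀ p : G.PosPath, P p.s * T p = T p
  kp2_ghost_range : ∀ p : G.PosPath, T p * P p.r = T p
  kp3 : ∀ p q : G.PosPath, p.d = q.d → T p * S q = if p = q then P p.s else 0
  /-- For `n ≠ 0`, `P v` is the sum of `S p * T p` over the set `F` of all `p ∈ vΛ^n`. -/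
  kp4 : ∀ (a : Λ) (n : Fin k → ℕ), n ≠ 0 →
    ∀ F : Finset G.PosPath, (∀ p : G.PosPath, p ∈ F ↔ p.r = a ∧ p.d = n) →
      P a = ∑ p ∈ F, S p * T p

end Family

namespace KumjianPask

variable (R : Type w) [CommRing R] {k : ℕ} {Λ : Type u} [Category.{v} Λ] (G : KGraph k Λ)

/-- The generating symbols: vertices, paths of nonzero degree and their ghost paths. -/
inductive Gen : Type (max u v)
  | vertex : Λ → Gen
  | path : G.PosPath → Gen
  | ghost : G.PosPath → Gen

/-- The free (associative, non-unital) `R`-algebra on the generating symbols: the semigroup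
algebra of the free semigroup. -/
abbrev Free : Type (max u v w) := MonoidAlgebra R (FreeSemigroup (Gen G))

/-- A generating symbol as an element of the free algebra. -/
noncomputable def Free.of (g : Gen G) : Free R G :=
  MonoidAlgebra.single (FreeSemigroup.of g) 1

variable {R G} in
/-- A vertex as an element of the free algebra. -/
noncomputable abbrev Free.P (a : Λ) : Free R G := Free.of R G (Gen.vertex a)

variable {R G} in
/-- A path as an element of the free algebra. -/
noncomputable abbrev Free.S (p : G.PosPath) : Free R G := Free.of R G (Gen.path p)

variable {R G} in
/-- A ghost path as an element of the free algebra. -/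
noncomputable abbrev Free.T (p : G.PosPath) : Free R G := Free.of R G (Gen.ghost p)

open scoped Classical in
/-- The defining relations (KP1)–(KP4), as pairs of elements of the free algebra. -/
inductive Rel : Free R G → Free R G → Prop
  | kp1 (a b : Λ) : Rel (Free.P a * Free.P b) (if a = b then Free.P a else 0)
  | kp2_path (p q : G.PosPath) (h : q.r = p.s) :
      Rel (Free.S p * Free.S q) (Free.S (p.comp q h))
  | kp2_ghost (p q : G.PosPath) (h : q.r = p.s) :
      Rel (Free.T q * Free.T p) (Free.T (p.comp q h))
  | kp2_range_path (p : G.PosPath) : Rel (Free.P p.r * Free.S p) (Free.S p)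
  | kp2_path_source (p : G.PosPath) : Rel (Free.S p * Free.P p.s) (Free.S p)
  | kp2_source_ghost (p : G.PosPath) : Rel (Free.P p.s * Free.T p) (Free.T p)
  | kp2_ghost_range (p : G.PosPath) : Rel (Free.T p * Free.P p.r) (Free.T p)
  | kp3 (p q : G.PosPath) (h : p.d = q.d) :
      Rel (Free.T p * Free.S q) (if p = q then Free.P p.s else 0)
  | kp4 (a : Λ) (n : Fin k → ℕ) (hn : n ≠ 0) (F : Finset G.PosPath)
      (hF : ∀ p : G.PosPath, p ∈ F ↔ p.r = a ∧ p.d = n) :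
      Rel (Free.P a) (∑ p ∈ F, Free.S p * Free.T p)

/-- The `R`-submodules of the free algebra that are two-sided ideals and contain the differences
of the two sides of all relations. -/
structure IsRelIdeal (I : Submodule R (Free R G)) : Prop where
  mul_left_mem : ∀ (z : Free R G) {y : Free R G}, y ∈ I → z * y ∈ I
  mul_right_mem : ∀ (z : Free R G) {y : Free R G}, y ∈ I → y * z ∈ I
  sub_mem : ∀ {y z : Free R G}, Rel R G y z → y - z ∈ I

/-- The smallest two-sided (algebra) ideal containing the relations. -/
noncomputable def relIdeal : Submodule R (Free R G) :=
  sInf {I | IsRelIdeal R G I}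

theorem relIdeal_le {I : Submodule R (Free R G)} (hI : IsRelIdeal R G I) : relIdeal R G ≤ I :=
  sInf_le hI

theorem isRelIdeal_relIdeal : IsRelIdeal R G (relIdeal R G) where
  mul_left_mem z y hy := by
    rw [relIdeal, Submodule.mem_sInf] at hy ⊢
    exact fun I hI => IsRelIdeal.mul_left_mem hI z (hy I hI)
  mul_right_mem z y hy := by
    rw [relIdeal, Submodule.mem_sInf] at hy ⊢
    exact fun I hI => IsRelIdeal.mul_right_mem hI z (hy I hI)
  sub_mem h := by
    rw [relIdeal, Submodule.mem_sInf]
    exact fun I hI => IsRelIdeal.sub_mem hI h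

end KumjianPask

/-- The Kumjian–Pask algebra `KP_R(Λ)`: the free `R`-algebra on vertices, paths of nonzero degree
and ghost paths, modulo the relations (KP1)–(KP4). -/
def KumjianPask (R : Type w) [CommRing R] {k : ℕ} {Λ : Type u} [Category.{v} Λ]
    (G : KGraph k Λ) : Type (max u v w) :=
  KumjianPask.Free R G ⧸ KumjianPask.relIdeal R G

namespace KumjianPask

variable (R : Type w) [CommRing R] {k : ℕ} {Λ : Type u} [Category.{v} Λ] (G : KGraph k Λ)

noncomputable instance : AddCommGroup (KumjianPask R G) :=
  inferInstanceAs (AddCommGroup (Free R G ⧸ relIdeal R G))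

noncomputable instance : Module R (KumjianPask R G) :=
  inferInstanceAs (Module R (Free R G ⧸ relIdeal R G))

/-- The quotient map. -/
noncomputable def mk : Free R G →ₗ[R] KumjianPask R G := (relIdeal R G).mkQ

theorem mk_surjective : Function.Surjective (mk R G) := (relIdeal R G).mkQ_surjective

theorem mk_eq_iff {y z : Free R G} : mk R G y = mk R G z ↔ y - z ∈ relIdeal R G :=
  Submodule.Quotient.eq _

noncomputable instance : Mul (KumjianPask R G) where
  mul := Quotient.map₂ (· * ·) (by
    intro y y' hy z z' hz
    have hy' := (Submodule.quotientRel_def _).1 hy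
    have hz' := (Submodule.quotientRel_def _).1 hz
    refine (Submodule.quotientRel_def _).2 ?_
    have h := (relIdeal R G).add_mem
      ((isRelIdeal_relIdeal R G).mul_right_mem z hy')
      ((isRelIdeal_relIdeal R G).mul_left_mem y' hz')
    rwa [sub_mul, mul_sub, sub_add_sub_cancel] at h)

theorem mk_mul (y z : Free R G) : mk R G (y * z) = mk R G y * mk R G z := rfl

noncomputable instance : NonUnitalRing (KumjianPask R G) where
  left_distrib a b c := by
    obtain ⟨a, rfl⟩ := mk_surjective R G a
    obtain ⟨b, rfl⟩ := mk_surjective R G b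
    obtain ⟨c, rfl⟩ := mk_surjective R G c
    simp only [← map_add, ← mk_mul, mul_add]
  right_distrib a b c := by
    obtain ⟨a, rfl⟩ := mk_surjective R G a
    obtain ⟨b, rfl⟩ := mk_surjective R G b
    obtain ⟨c, rfl⟩ := mk_surjective R G c
    simp only [← map_add, ← mk_mul, add_mul]
  zero_mul a := by
    obtain ⟨a, rfl⟩ := mk_surjective R G a
    rw [← map_zero (mk R G), ← mk_mul, zero_mul]
  mul_zero a := by
    obtain ⟨a, rfl⟩ := mk_surjective R G a
    rw [← map_zero (mk R G), ← mk_mul, mul_zero]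
  mul_assoc a b c := by
    obtain ⟨a, rfl⟩ := mk_surjective R G a
    obtain ⟨b, rfl⟩ := mk_surjective R G b
    obtain ⟨c, rfl⟩ := mk_surjective R G c
    simp only [← mk_mul, mul_assoc]

instance : IsScalarTower R (KumjianPask R G) (KumjianPask R G) where
  smul_assoc r a b := by
    obtain ⟨a, rfl⟩ := mk_surjective R G a
    obtain ⟨b, rfl⟩ := mk_surjective R G b
    simp only [smul_eq_mul, ← map_smul, ← mk_mul, smul_mul_assoc]

instance : SMulCommClass R (KumjianPask R G) (KumjianPask R G) where
  smul_comm r a b := by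
    obtain ⟨a, rfl⟩ := mk_surjective R G a
    obtain ⟨b, rfl⟩ := mk_surjective R G b
    simp only [smul_eq_mul, ← map_smul, ← mk_mul, mul_smul_comm]

/-- The generator `p_v`. -/
noncomputable def p (a : Λ) : KumjianPask R G := mk R G (Free.P a)

/-- The generator `s_λ`. -/
noncomputable def s (l : G.PosPath) : KumjianPask R G := mk R G (Free.S l)

/-- The generator `s_{λ^*}`. -/
noncomputable def t (l : G.PosPath) : KumjianPask R G := mk R G (Free.T l)

theorem mk_eq_of_rel {y z : Free R G} (h : Rel R G y z) : mk R G y = mk R G z :=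
  (mk_eq_iff R G).2 ((isRelIdeal_relIdeal R G).sub_mem h)

/-- The generators form a Kumjian–Pask family. -/
theorem isKumjianPaskFamily : IsKumjianPaskFamily G (p R G) (s R G) (t R G) where
  kp1 a b := by
    have h := mk_eq_of_rel R G (Rel.kp1 a b)
    rw [mk_mul, apply_ite (mk R G), map_zero] at h
    exact h
  kp2_path l m h := mk_eq_of_rel R G (Rel.kp2_path l m h)
  kp2_ghost l m h := mk_eq_of_rel R G (Rel.kp2_ghost l m h)
  kp2_range_path l := mk_eq_of_rel R G (Rel.kp2_range_path l)
  kp2_path_source l := mk_eq_of_rel R G (Rel.kp2_path_source l)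
  kp2_source_ghost l := mk_eq_of_rel R G (Rel.kp2_source_ghost l)
  kp2_ghost_range l := mk_eq_of_rel R G (Rel.kp2_ghost_range l)
  kp3 l m hd := by
    have h := mk_eq_of_rel R G (Rel.kp3 l m hd)
    rw [mk_mul, apply_ite (mk R G), map_zero] at h
    exact h
  kp4 a n hn F hF := by
    have h := mk_eq_of_rel R G (Rel.kp4 a n hn F hF)
    rw [map_sum] at h
    exact h

/-- The universal property: a Kumjian–Pask family in an `R`-algebra `A` is the image of the
generators under a unique `R`-algebra homomorphism. -/
theorem existsUnique_hom {A : Type x} [NonUnitalRing A] [Module R A] [IsScalarTower R A A]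
    [SMulCommClass R A A] {P : Λ → A} {S T : G.PosPath → A} (h : IsKumjianPaskFamily G P S T) :
    ∃! f : KumjianPask R G →ₙₐ[R] A,
      (∀ a, f (p R G a) = P a) ∧ (∀ l, f (s R G l) = S l) ∧ (∀ l, f (t R G l) = T l) := by
  classical
  let φ : Gen G → A := fun g => match g with
    | .vertex a => P a
    | .path l => S l
    | .ghost l => T l
  let F : Free R G →ₙₐ[R] A := MonoidAlgebra.liftMagma R (FreeSemigroup.lift φ)
  have hF : ∀ g, F (Free.of R G g) = φ g := by
    intro g
    simp [F, Free.of]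
  have hle : relIdeal R G ≤ LinearMap.ker (F : Free R G →ₗ[R] A) := by
    refine relIdeal_le R G ⟨?_, ?_, ?_⟩
    · intro z y hy
      have hy' : F y = 0 := hy
      change F (z * y) = 0
      rw [map_mul, hy', mul_zero]
    · intro z y hy
      have hy' : F y = 0 := hy
      change F (y * z) = 0
      rw [map_mul, hy', zero_mul]
    · intro y z hyz
      change F (y - z) = 0
      rw [map_sub, sub_eq_zero]
      cases hyz with
      | kp1 a b => rw [map_mul, apply_ite F, map_zero, hF, hF]; exact h.kp1 a b
      | kp2_path l m e => rw [map_mul, hF, hF, hF]; exact h.kp2_path l m e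
      | kp2_ghost l m e => rw [map_mul, hF, hF, hF]; exact h.kp2_ghost l m e
      | kp2_range_path l => rw [map_mul, hF, hF]; exact h.kp2_range_path l
      | kp2_path_source l => rw [map_mul, hF, hF]; exact h.kp2_path_source l
      | kp2_source_ghost l => rw [map_mul, hF, hF]; exact h.kp2_source_ghost l
      | kp2_ghost_range l => rw [map_mul, hF, hF]; exact h.kp2_ghost_range l
      | kp3 l m e => rw [map_mul, apply_ite F, map_zero, hF, hF, hF]; exact h.kp3 l m e
      | kp4 a n hn E hE =>
        rw [map_sum, hF]
        simp only [map_mul, hF]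
        exact h.kp4 a n hn E hE
  let f₀ : KumjianPask R G →ₗ[R] A := (relIdeal R G).liftQ (F : Free R G →ₗ[R] A) hle
  have hf₀ : ∀ y, f₀ (mk R G y) = F y := fun y => rfl
  let f : KumjianPask R G →ₙₐ[R] A :=
    { f₀ with
      map_zero' := map_zero f₀
      map_mul' := by
        intro y z
        obtain ⟨y, rfl⟩ := mk_surjective R G y
        obtain ⟨z, rfl⟩ := mk_surjective R G z
        change f₀ (mk R G y * mk R G z) = f₀ (mk R G y) * f₀ (mk R G z)
        rw [← mk_mul, hf₀, hf₀, hf₀, map_mul] }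
  have hf : ∀ y, f (mk R G y) = F y := hf₀
  refine ⟨f, ⟨fun a => (hf _).trans (hF _), fun l => (hf _).trans (hF _),
    fun l => (hf _).trans (hF _)⟩, ?_⟩
  rintro g ⟨hP, hS, hT⟩
  let q : Free R G →ₙₐ[R] KumjianPask R G :=
    { mk R G with
      map_zero' := map_zero (mk R G)
      map_mul' := mk_mul R G }
  have key : ∀ y, (g.comp q) y = F y := by
    have e : g.comp q = F := by
      apply (MonoidAlgebra.liftMagma R).symm.injective
      rw [Equiv.symm_apply_apply]
      apply FreeSemigroup.hom_ext
      funext b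
      have h1 : g (mk R G (Free.of R G b)) = φ b := by
        cases b with
        | vertex a => exact hP a
        | path l => exact hS l
        | ghost l => exact hT l
      rw [MonoidAlgebra.liftMagma_symm_apply]
      exact h1.trans (FreeSemigroup.lift_of φ b).symm
    intro y
    rw [e]
  ext y
  obtain ⟨y, rfl⟩ := mk_surjective R G y
  exact (key y).trans (hf y).symm

end KumjianPask

-- Finite sums of distinct vertices `p_v` are local units: every generator is fixed on each side by
-- a vertex, and vertices are mutually orthogonal idempotents, so each element is fixed by the sum
-- over any large enough finite vertex set (`exists_local_unit`). If there are finitely many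
-- vertices, the sum of all of them is an identity. Conversely, let `e` be an identity fixed by the
-- sum over a finite set `V`. For `a` outside `V`, `p_a = p_a e = p_a (∑ b ∈ V, p_b) e = 0`.
-- Infinitely many vertices are therefore excluded once every `p_a` is known to be nonzero
-- (`p_ne_zero`).
--
-- For this a representation is needed in which `p_a` acts nontrivially. Paths act on infinite paths
-- by prepending, and unique factorization turns this into a Kumjian–Pask family on functions on
-- infinite paths. Instead of all infinite paths, it suffices to fix one with range `a` and take
-- those sharing a tail with it; they form the filtered colimit of the sets `X_i ⟶ b` along an
-- inverse sequence `X` ending at `a`. No sources provides such a sequence of unbounded degree.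

universe y

/-! ### Partial bijections and the linear operators they induce -/

namespace PEquiv

open scoped Classical in
/-- The partial bijection given by a functional and injective relation. -/
noncomputable def ofRel {α : Type*} {β : Type*} (r : α → β → Prop)
    (hfun : ∀ a b b', r a b → r a b' → b = b') (hinj : ∀ a a' b, r a b → r a' b → a = a') :
    α ≃. β where
  toFun a := if h : ∃ b, r a b then some h.choose else none
  invFun b := if h : ∃ a, r a b then some h.choose else none
  inv a b := by
    have h1 : (a ∈ if h : ∃ a, r a b then some h.choose else none) ↔ r a b := by
      split_ifs with h
      · rw [Option.mem_some_iff]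
        exact ⟨fun e => e ▸ h.choose_spec, fun e => hinj _ _ _ h.choose_spec e⟩
      · simpa using fun e => h ⟨a, e⟩
    have h2 : (b ∈ if h : ∃ b, r a b then some h.choose else none) ↔ r a b := by
      split_ifs with h
      · rw [Option.mem_some_iff]
        exact ⟨fun e => e ▸ h.choose_spec, fun e => hfun _ _ _ h.choose_spec e⟩
      · simpa using fun e => h ⟨b, e⟩
    exact h1.trans h2.symm

theorem mem_ofRel {α : Type*} {β : Type*} (r : α → β → Prop) (hfun) (hinj) (a : α) (b : β) :
    b ∈ ofRel r hfun hinj a ↔ r a b := by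
  classical
  change (b ∈ if h : ∃ b, r a b then some h.choose else none) ↔ r a b
  split_ifs with h
  · rw [Option.mem_some_iff]
    exact ⟨fun e => e ▸ h.choose_spec, fun e => hfun _ _ _ h.choose_spec e⟩
  · simpa using fun e => h ⟨b, e⟩

/-- Precomposition with a partial bijection of `α`, extended by zero, as an endomorphism of the
module of functions `α → R`. -/
def toEnd (R : Type*) [CommRing R] {α : Type*} (e : α ≃. α) : Module.End R (α → R) where
  toFun φ a := (e a).elim 0 φ
  map_add' φ ψ := by
    funext a
    cases h : e a <;> simp [h]
  map_smul' c φ := by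
    funext a
    cases h : e a <;> simp [h]

variable {R : Type*} [CommRing R] {α : Type*}

theorem toEnd_apply_of_mem {e : α ≃. α} {a b : α} (h : b ∈ e a) (φ : α → R) :
    toEnd R e φ a = φ b := by
  change (e a).elim 0 φ = φ b
  rw [Option.mem_def.1 h, Option.elim_some]

theorem toEnd_apply_of_forall_notMem {e : α ≃. α} {a : α} (h : ∀ b, b ∉ e a) (φ : α → R) :
    toEnd R e φ a = 0 := by
  change (e a).elim 0 φ = 0
  rw [Option.eq_none_iff_forall_not_mem.2 h, Option.elim_none]

/-- Precomposition is contravariant and `trans` is written in diagrammatic order, so the two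
reversals cancel. -/
theorem toEnd_trans (e f : α ≃. α) : toEnd R (e.trans f) = toEnd R e * toEnd R f := by
  ext φ a
  change ((e a).bind f).elim 0 φ = (e a).elim 0 fun b => (f b).elim 0 φ
  cases e a <;> rfl

theorem toEnd_bot : toEnd R (⊥ : α ≃. α) = 0 := rfl

end PEquiv

/-! ### Path spaces and the Kumjian–Pask families they carry -/

namespace KGraph

variable {k : ℕ} {Λ : Type u} [Category.{v} Λ]

/-- A covariant action of the paths of a `k`-graph on a family of sets such that every element
factors uniquely through a path of any given degree; the model is the action on infinite paths. -/
structure PathSpace (G : KGraph k Λ) where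
  /-- The elements with a given range. -/
  E : Λ → Type y
  /-- Prepending a path. -/
  map : ∀ {a b : Λ}, (a ⟶ b) → E a → E b
  map_id : ∀ (a : Λ) (e : E a), map (𝟙 a) e = e
  map_comp : ∀ {a b c : Λ} (m : a ⟶ b) (l : b ⟶ c) (e : E a), map (m ≫ l) e = map l (map m e)
  existsUnique_factor : ∀ (b : Λ) (n : Fin k → ℕ) (e : E b),
    ∃! q : Σ a : Λ, (a ⟶ b) × E a, G.deg q.2.1 = n ∧ map q.2.1 q.2.2 = e

namespace PathSpace

variable {G : KGraph k Λ} (X : PathSpace.{v, u, y} G)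

/-- Uniqueness of the prefix of a given degree. It makes prepending injective and gives distinct
paths of equal degree disjoint images, which is the source of (KP3). -/
theorem map_eq_map {a a' b : Λ} {l : a ⟶ b} {l' : a' ⟶ b} (hd : G.deg l = G.deg l') {e : X.E a}
    {e' : X.E a'} (h : X.map l e = X.map l' e') :
    (⟨a, l, e⟩ : Σ a : Λ, (a ⟶ b) × X.E a) = ⟨a', l', e'⟩ :=
  (X.existsUnique_factor b (G.deg l') (X.map l' e')).unique ⟨hd, h⟩ ⟨rfl, rfl⟩

theorem map_injective {a b : Λ} (l : a ⟶ b) : Function.Injective (X.map l) := by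
  intro e e' h
  have := X.map_eq_map rfl h
  simpa using this

/-- Prepending a path, as a partial bijection of the total space. -/
noncomputable def act {a b : Λ} (l : a ⟶ b) : (Σ a, X.E a) ≃. (Σ a, X.E a) :=
  PEquiv.ofRel (fun y z => ∃ e : X.E a, y = ⟨a, e⟩ ∧ z = ⟨b, X.map l e⟩)
    (by
      rintro _ _ _ ⟨e, rfl, rfl⟩ ⟨e', h, rfl⟩
      obtain rfl : e = e' := by simpa using h
      rfl)
    (by
      rintro _ _ _ ⟨e, rfl, rfl⟩ ⟨e', rfl, h⟩
      obtain rfl : e = e' := X.map_injective l (by simpa using h)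
      rfl)

variable {X}

theorem mem_act {a b : Λ} {l : a ⟶ b} {y z : Σ a, X.E a} :
    z ∈ X.act l y ↔ ∃ e : X.E a, y = ⟨a, e⟩ ∧ z = ⟨b, X.map l e⟩ :=
  PEquiv.mem_ofRel ..

theorem mem_act_id {a : Λ} {y z : Σ a, X.E a} : z ∈ X.act (𝟙 a) y ↔ y.1 = a ∧ z = y := by
  rw [mem_act]
  constructor
  · rintro ⟨e, rfl, rfl⟩
    exact ⟨rfl, by rw [X.map_id]⟩
  · rintro ⟨rfl, rfl⟩
    exact ⟨z.2, rfl, by rw [X.map_id]⟩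

theorem self_mem_act_id {a : Λ} (e : X.E a) :
    (⟨a, e⟩ : Σ a, X.E a) ∈ X.act (𝟙 a) ⟨a, e⟩ :=
  mem_act_id.2 ⟨rfl, rfl⟩

theorem act_comp {a b c : Λ} (m : a ⟶ b) (l : b ⟶ c) :
    X.act (m ≫ l) = (X.act m).trans (X.act l) := by
  refine PEquiv.ext fun y => Option.ext fun z => ?_
  rw [← Option.mem_def, ← Option.mem_def, PEquiv.mem_trans, mem_act]
  simp only [mem_act]
  constructor
  · rintro ⟨e, rfl, rfl⟩
    exact ⟨_, ⟨e, rfl, rfl⟩, _, rfl, by rw [X.map_comp]⟩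
  · rintro ⟨_, ⟨e, rfl, rfl⟩, e', h, rfl⟩
    obtain rfl : X.map m e = e' := by simpa using h
    exact ⟨e, rfl, by rw [X.map_comp]⟩

theorem act_id_symm (a : Λ) : (X.act (𝟙 a)).symm = X.act (𝟙 a) := by
  refine PEquiv.ext fun y => Option.ext fun z => ?_
  rw [← Option.mem_def, ← Option.mem_def, PEquiv.mem_iff_mem, mem_act_id, mem_act_id]
  constructor <;> rintro ⟨h, rfl⟩ <;> exact ⟨h, rfl⟩

theorem act_id_trans_act_id_of_ne {a b : Λ} (h : a ≠ b) :
    (X.act (𝟙 a)).trans (X.act (𝟙 b)) = ⊥ := by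
  refine PEquiv.ext fun y => Option.eq_none_iff_forall_not_mem.2 fun z hz => ?_
  obtain ⟨w, h1, h2⟩ := (PEquiv.mem_trans _ _ _ _).1 hz
  rw [mem_act_id] at h1 h2
  obtain ⟨h1, rfl⟩ := h1
  exact h (h1.symm.trans h2.1)

theorem act_trans_symm_self {a b : Λ} (l : a ⟶ b) :
    (X.act l).trans (X.act l).symm = X.act (𝟙 a) := by
  refine PEquiv.ext fun y => Option.ext fun z => ?_
  rw [← Option.mem_def, ← Option.mem_def, PEquiv.mem_trans, mem_act_id]
  simp only [PEquiv.mem_iff_mem]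
  constructor
  · rintro ⟨w, h1, h2⟩
    obtain rfl := PEquiv.inj _ h1 h2
    obtain ⟨e, rfl, -⟩ := mem_act.1 h1
    exact ⟨rfl, rfl⟩
  · rintro ⟨rfl, rfl⟩
    exact ⟨_, mem_act.2 ⟨z.2, rfl, rfl⟩, mem_act.2 ⟨z.2, rfl, rfl⟩⟩

/-- A point where the composite is defined would yield an element with both `p` and `q` as prefixes
of the same degree. -/
theorem act_trans_symm_of_ne {p q : G.PosPath} (hd : p.d = q.d) (h : p ≠ q) :
    (X.act p.hom).trans (X.act q.hom).symm = ⊥ := by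
  refine PEquiv.ext fun y => Option.eq_none_iff_forall_not_mem.2 fun z hz => h ?_
  obtain ⟨w, h1, h2⟩ := (PEquiv.mem_trans _ _ _ _).1 hz
  rw [PEquiv.mem_iff_mem] at h2
  obtain ⟨e, rfl, rfl⟩ := mem_act.1 h1
  obtain ⟨e', rfl, he⟩ := mem_act.1 h2
  obtain ⟨a, b, l, hl⟩ := p
  obtain ⟨a', b', l', hl'⟩ := q
  obtain rfl : b = b' := congrArg Sigma.fst he
  have := X.map_eq_map (l := l) (l' := l') hd (by simpa using he)
  cases this
  rfl

/-- The vertices and the paths of nonzero degree act on functions on a path space by a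
Kumjian–Pask family. -/
theorem isKumjianPaskFamily (R : Type w) [CommRing R] (X : PathSpace.{v, u, y} G) :
    IsKumjianPaskFamily G (fun a => PEquiv.toEnd R (X.act (𝟙 a)))
      (fun p => PEquiv.toEnd R (X.act p.hom).symm) (fun p => PEquiv.toEnd R (X.act p.hom)) where
  kp1 a b := by
    rw [← PEquiv.toEnd_trans]
    split_ifs with h
    · subst h
      rw [← act_comp, Category.comp_id]
    · rw [act_id_trans_act_id_of_ne h, PEquiv.toEnd_bot]
  kp2_path p q h := by
    obtain ⟨a, b, l, hl⟩ := p
    obtain ⟨a', b', m, hm⟩ := q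
    dsimp only at h
    subst h
    rw [← PEquiv.toEnd_trans, ← PEquiv.symm_trans_rev, ← act_comp]
    simp [PosPath.comp]
  kp2_ghost p q h := by
    obtain ⟨a, b, l, hl⟩ := p
    obtain ⟨a', b', m, hm⟩ := q
    dsimp only at h
    subst h
    rw [← PEquiv.toEnd_trans, ← act_comp]
    simp [PosPath.comp]
  kp2_range_path p := by
    rw [← PEquiv.toEnd_trans, ← act_id_symm, ← PEquiv.symm_trans_rev, ← act_comp,
      Category.comp_id]
  kp2_path_source p := by
    rw [← PEquiv.toEnd_trans, ← act_id_symm, ← PEquiv.symm_trans_rev, ← act_comp,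
      Category.id_comp]
  kp2_source_ghost p := by
    rw [← PEquiv.toEnd_trans, ← act_comp, Category.id_comp]
  kp2_ghost_range p := by
    rw [← PEquiv.toEnd_trans, ← act_comp, Category.comp_id]
  kp3 p q hd := by
    rw [← PEquiv.toEnd_trans]
    split_ifs with h
    · subst h
      rw [act_trans_symm_self]
    · rw [act_trans_symm_of_ne hd h, PEquiv.toEnd_bot]
  kp4 a n hn F hF := by
    refine LinearMap.ext fun φ => funext fun y => ?_
    simp only [LinearMap.sum_apply, Finset.sum_apply, Module.End.mul_apply]
    by_cases hy : y.1 = a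
    · obtain ⟨b, e⟩ := y
      dsimp only at hy
      subst hy
      -- Only the summand of the degree `n` prefix `l` of `e` survives: any other path of that
      -- degree is not a prefix of `e`, so its term evaluates to the default value 0.
      obtain ⟨⟨c, l, e'⟩, ⟨hd, rfl⟩, -⟩ := X.existsUnique_factor b n e
      dsimp only at hd e' ⊢
      have hl : G.deg l ≠ 0 := hd ▸ hn
      rw [PEquiv.toEnd_apply_of_mem (self_mem_act_id _),
        Finset.sum_eq_single_of_mem (⟨c, b, l, hl⟩ : G.PosPath) ((hF _).2 ⟨rfl, hd⟩)]
      · have hm : (⟨b, X.map l e'⟩ : Σ a, X.E a) ∈ X.act l ⟨c, e'⟩ := mem_act.2 ⟨e', rfl, rfl⟩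
        rw [PEquiv.toEnd_apply_of_mem ((PEquiv.mem_iff_mem _).2 hm), PEquiv.toEnd_apply_of_mem hm]
      · rintro ⟨c', b', l', hl'⟩ hp hne
        obtain ⟨hb, hd'⟩ := (hF _).1 hp
        dsimp only at hb
        subst hb
        refine PEquiv.toEnd_apply_of_forall_notMem (fun z hz => hne ?_) _
        obtain ⟨e'', -, he⟩ := mem_act.1 ((PEquiv.mem_iff_mem _).1 hz)
        have := X.map_eq_map (l := l) (l' := l') (hd.trans hd'.symm) (by simpa using he)
        cases this
        rfl
    -- At a point with range other than `a` both sides vanish.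
    · rw [PEquiv.toEnd_apply_of_forall_notMem fun z hz => hy (mem_act_id.1 hz).1]
      refine (Finset.sum_eq_zero fun p hp => ?_).symm
      refine PEquiv.toEnd_apply_of_forall_notMem (fun z hz => hy ?_) _
      obtain ⟨e, -, rfl⟩ := mem_act.1 ((PEquiv.mem_iff_mem _).1 hz)
      exact ((hF p).1 hp).1

end PathSpace

/-! ### Infinite paths sharing a tail with a given one -/

/-- Two paths out of the members of an inverse sequence are equivalent if they agree from some
stage on. -/
def tailSetoid (X : ℕᵒᵖ ⥤ Λ) (b : Λ) : Setoid (Σ i : ℕᵒᵖ, (X.obj i ⟶ b)) where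
  r x y := ∃ (j : ℕᵒᵖ) (f : j ⟶ x.1) (g : j ⟶ y.1), X.map f ≫ x.2 = X.map g ≫ y.2
  iseqv := by
    refine ⟨fun x => ⟨x.1, 𝟙 _, 𝟙 _, rfl⟩, fun ⟨j, f, g, h⟩ => ⟨j, g, f, h.symm⟩, ?_⟩
    rintro x y z ⟨j, f, g, h⟩ ⟨j', f', g', h'⟩
    refine ⟨IsCofiltered.min j j', IsCofiltered.minToLeft j j' ≫ f,
      IsCofiltered.minToRight j j' ≫ g', ?_⟩
    rw [X.map_comp, X.map_comp, Category.assoc, Category.assoc, h, ← h', ← Category.assoc,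
      ← Category.assoc, ← X.map_comp, ← X.map_comp]
    congr 2

variable {G : KGraph k Λ}

/-- The infinite paths which eventually agree with a given infinite path, presented as an inverse
sequence of paths of unbounded degree. -/
def tailPathSpace (X : ℕᵒᵖ ⥤ Λ)
    (hX : ∀ (i : ℕᵒᵖ) (n : Fin k → ℕ), ∃ (j : ℕᵒᵖ) (f : j ⟶ i), n ≤ G.deg (X.map f)) :
    PathSpace.{v, u, v} G where
  E b := Quotient (tailSetoid X b)
  map l := Quotient.map (fun x => ⟨x.1, x.2 ≫ l⟩) (by
    rintro x y ⟨j, f, g, h⟩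
    exact ⟨j, f, g, by simp only [← Category.assoc, h]⟩)
  map_id a e := by
    induction e using Quotient.inductionOn with
    | h x => simp
  map_comp m l e := by
    induction e using Quotient.inductionOn with
    | h x => simp
  existsUnique_factor b n e := by
    induction e using Quotient.inductionOn with
    | h x =>
    obtain ⟨i, g⟩ := x
    -- Moving the representative far enough along the sequence gives it degree at least `n`, so that
    -- a prefix of degree `n` can be split off inside `Λ`.
    obtain ⟨j, f, hf⟩ := hX i n
    obtain ⟨⟨c, l, m⟩, ⟨hl, hm, hlm⟩, -⟩ := G.factorization (X.map f ≫ g) n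
      (G.deg (X.map f ≫ g) - n) (by
        rw [add_tsub_cancel_of_le]
        rw [G.deg_comp]
        exact hf.trans le_add_self)
    refine ⟨⟨c, l, Quotient.mk _ ⟨j, m⟩⟩, ⟨hl, Quotient.sound ⟨j, 𝟙 _, f, ?_⟩⟩, ?_⟩
    · simpa using hlm
    · rintro ⟨c', l', e'⟩ ⟨hl', he⟩
      dsimp only at hl' hl hlm hm
      induction e' using Quotient.inductionOn with
      | h x' =>
      obtain ⟨i', m'⟩ := x'
      obtain ⟨t, u, v, huv⟩ := Quotient.exact he
      dsimp only at u v huv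
      -- Both factorizations are compared at a common stage `w`, where they become factorizations of
      -- one path in `Λ`; the square commutes because `ℕᵒᵖ` is thin.
      obtain ⟨w, α, β, hαβ⟩ : ∃ (w : ℕᵒᵖ) (α : w ⟶ t) (β : w ⟶ j), α ≫ v = β ≫ f :=
        ⟨_, IsCofiltered.minToLeft t j, IsCofiltered.minToRight t j, Subsingleton.elim _ _⟩
      have key : (X.map (α ≫ u) ≫ m') ≫ l' = (X.map β ≫ m) ≫ l := by
        rw [Category.assoc, Category.assoc, hlm, X.map_comp, Category.assoc, huv,
          ← Category.assoc, ← Category.assoc, ← X.map_comp, ← X.map_comp, hαβ]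
      have hdeg : G.deg (X.map (α ≫ u) ≫ m') = G.deg (X.map β ≫ m) := by
        have := congrArg G.deg key
        rw [G.deg_comp _ l', G.deg_comp _ l, hl, hl'] at this
        exact add_left_cancel this
      have huniq := (G.factorization ((X.map β ≫ m) ≫ l) n (G.deg (X.map β ≫ m))
        (by rw [G.deg_comp, hl])).unique (y₁ := ⟨c', l', X.map (α ≫ u) ≫ m'⟩)
          (y₂ := ⟨c, l, X.map β ≫ m⟩) ⟨hl', hdeg, key⟩ ⟨hl, rfl, rfl⟩
      obtain ⟨rfl, h2⟩ := Sigma.mk.inj huniq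
      obtain ⟨rfl, h3⟩ := Prod.mk.inj (eq_of_heq h2)
      have : (Quotient.mk (tailSetoid X c') ⟨i', m'⟩) = Quotient.mk _ ⟨j, m⟩ :=
        Quotient.sound ⟨w, α ≫ u, β, h3⟩
      rw [this]

/-- In a `k`-graph without sources every vertex is the range of an inverse sequence of paths of
unbounded degree. -/
theorem NoSources.exists_sequence (hsrc : G.NoSources) (a : Λ) :
    ∃ X : ℕᵒᵖ ⥤ Λ, X.obj (Opposite.op 0) = a ∧
      ∀ (i : ℕᵒᵖ) (n : Fin k → ℕ), ∃ (j : ℕᵒᵖ) (f : j ⟶ i), n ≤ G.deg (X.map f) := by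
  -- Degree `1` is `(1, …, 1)`, so iterating the choice makes all coordinates grow together.
  choose σ hσ using fun b : Λ => show ∃ p : Σ a : Λ, (a ⟶ b), G.deg p.2 = 1 from
    let ⟨p⟩ := hsrc b 1; ⟨p.1, p.2⟩
  let o : ℕ → Λ := fun i => Nat.rec a (fun _ b => (σ b).1) i
  let s : ∀ i, o (i + 1) ⟶ o i := fun i => (σ (o i)).2
  refine ⟨Functor.ofOpSequence s, rfl, fun i n => ?_⟩
  have hdeg : ∀ m : ℕ, ∃ (j : ℕᵒᵖ) (f : j ⟶ i),
      G.deg ((Functor.ofOpSequence s).map f) = fun _ => m := by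
    intro m
    induction m with
    | zero => exact ⟨i, 𝟙 i, by rw [CategoryTheory.Functor.map_id, G.deg_id]; rfl⟩
    | succ m ih =>
      obtain ⟨j, f, hf⟩ := ih
      refine ⟨Opposite.op (j.unop + 1), (homOfLE (Nat.le_add_right j.unop 1)).op ≫ f, ?_⟩
      have h1 := Functor.ofOpSequence_map_homOfLE_succ s j.unop
      rw [Functor.map_comp, G.deg_comp, hf]
      erw [h1, hσ]
      rfl
  -- The sum of the coordinates bounds each of them, also when `k = 0`.
  obtain ⟨j, f, hf⟩ := hdeg (∑ c, n c)
  refine ⟨j, f, fun c => ?_⟩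
  rw [hf]
  exact Finset.single_le_sum (fun _ _ => Nat.zero_le _) (Finset.mem_univ c)

theorem NoSources.exists_pathSpace (hsrc : G.NoSources) (a : Λ) :
    ∃ X : PathSpace.{v, u, v} G, Nonempty (X.E a) := by
  obtain ⟨X, rfl, hX⟩ := hsrc.exists_sequence a
  exact ⟨tailPathSpace X hX, ⟨Quotient.mk _ ⟨_, 𝟙 _⟩⟩⟩

end KGraph

/-! ### Nonvanishing of vertices, and local units -/

namespace KumjianPask

variable (R : Type w) [CommRing R] {k : ℕ} {Λ : Type u} [Category.{v} Λ] {G : KGraph k Λ}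

theorem p_ne_zero [Nontrivial R] (hsrc : G.NoSources) (a : Λ) : p R G a ≠ 0 := by
  intro h0
  obtain ⟨X, ⟨e⟩⟩ := hsrc.exists_pathSpace a
  obtain ⟨f, ⟨hf, -, -⟩, -⟩ := existsUnique_hom R G (X.isKumjianPaskFamily R)
  have h : PEquiv.toEnd R (X.act (𝟙 a)) = 0 := by rw [← hf a, h0, map_zero]
  -- The constant function 1 keeps the value 1 at an infinite path with range `a`.
  have h1 := congrFun (LinearMap.congr_fun h 1) ⟨a, e⟩
  rw [PEquiv.toEnd_apply_of_mem (KGraph.PathSpace.self_mem_act_id e)] at h1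
  exact one_ne_zero h1

variable (G) in
theorem induction {C : KumjianPask R G → Prop} (zero : C 0) (add : ∀ x y, C x → C y → C (x + y))
    (smul : ∀ (r : R) (x), C x → C (r • x)) (mul : ∀ x y, C x → C y → C (x * y))
    (vertex : ∀ a, C (p R G a)) (path : ∀ l, C (s R G l)) (ghost : ∀ l, C (t R G l))
    (x : KumjianPask R G) : C x := by
  obtain ⟨z, rfl⟩ := mk_surjective R G x
  have hw : ∀ w : FreeSemigroup (Gen G), C (mk R G (MonoidAlgebra.single w 1)) := by
    intro w
    induction w using FreeSemigroup.recOnMul with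
    | ih1 g =>
      cases g with
      | vertex a => exact vertex a
      | path l => exact path l
      | ghost l => exact ghost l
    | ih2 g w hg hw =>
      rw [← mul_one (1 : R), ← MonoidAlgebra.single_mul_single, mk_mul]
      exact mul _ _ hg hw
  induction z using MonoidAlgebra.induction_linear with
  | zero => rw [map_zero]; exact zero
  | add y z hy hz => rw [map_add]; exact add _ _ hy hz
  | single w r =>
    have : (MonoidAlgebra.single w r : Free R G) = r • MonoidAlgebra.single w 1 := by simp
    rw [this, map_smul]
    exact smul _ _ (hw w)

theorem sum_p_mul_p {V : Finset Λ} {a : Λ} (ha : a ∈ V) :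
    (∑ b ∈ V, p R G b) * p R G a = p R G a := by
  rw [Finset.sum_mul, Finset.sum_eq_single_of_mem a ha, (isKumjianPaskFamily R G).kp1, if_pos rfl]
  intro b _ hb
  rw [(isKumjianPaskFamily R G).kp1, if_neg hb]

theorem p_mul_sum_p {V : Finset Λ} {a : Λ} (ha : a ∈ V) :
    p R G a * (∑ b ∈ V, p R G b) = p R G a := by
  rw [Finset.mul_sum, Finset.sum_eq_single_of_mem a ha, (isKumjianPaskFamily R G).kp1, if_pos rfl]
  intro b _ hb
  rw [(isKumjianPaskFamily R G).kp1, if_neg hb.symm]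

theorem p_mul_sum_p_of_notMem {V : Finset Λ} {a : Λ} (ha : a ∉ V) :
    p R G a * (∑ b ∈ V, p R G b) = 0 := by
  rw [Finset.mul_sum]
  refine Finset.sum_eq_zero fun b hb => ?_
  rw [(isKumjianPaskFamily R G).kp1, if_neg]
  rintro rfl
  exact ha hb

/-- The sums of finitely many vertices form local units of the Kumjian–Pask algebra. -/
theorem exists_local_unit (x : KumjianPask R G) :
    ∃ V : Finset Λ, ∀ W : Finset Λ, V ⊆ W →
      (∑ b ∈ W, p R G b) * x = x ∧ x * (∑ b ∈ W, p R G b) = x := by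
  classical
  have hKP := isKumjianPaskFamily R G
  induction x using induction R G with
  | zero => exact ⟨∅, fun W _ => ⟨mul_zero _, zero_mul _⟩⟩
  | add x y hx hy =>
    obtain ⟨V, hV⟩ := hx
    obtain ⟨V', hV'⟩ := hy
    -- Quantifying over all `W ⊇ V` lets one finite set serve both elements.
    refine ⟨V ∪ V', fun W hW => ?_⟩
    have h := hV W (Finset.union_subset_left hW)
    have h' := hV' W (Finset.union_subset_right hW)
    rw [mul_add, add_mul, h.1, h.2, h'.1, h'.2]
    exact ⟨rfl, rfl⟩
  | smul r x hx =>
    obtain ⟨V, hV⟩ := hx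
    refine ⟨V, fun W hW => ?_⟩
    rw [mul_smul_comm, smul_mul_assoc, (hV W hW).1, (hV W hW).2]
    exact ⟨rfl, rfl⟩
  | mul x y hx hy =>
    obtain ⟨V, hV⟩ := hx
    obtain ⟨V', hV'⟩ := hy
    refine ⟨V ∪ V', fun W hW => ?_⟩
    rw [← mul_assoc, mul_assoc x y, (hV W (Finset.union_subset_left hW)).1,
      (hV' W (Finset.union_subset_right hW)).2]
    exact ⟨rfl, rfl⟩
  | vertex a =>
    refine ⟨{a}, fun W hW => ?_⟩
    have ha : a ∈ W := hW (Finset.mem_singleton_self a)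
    exact ⟨sum_p_mul_p R ha, p_mul_sum_p R ha⟩
  | path l =>
    refine ⟨{l.r, l.s}, fun W hW => ⟨?_, ?_⟩⟩
    · rw [← hKP.kp2_range_path l, ← mul_assoc, sum_p_mul_p R (hW (by simp))]
    · rw [← hKP.kp2_path_source l, mul_assoc, p_mul_sum_p R (hW (by simp))]
  | ghost l =>
    refine ⟨{l.r, l.s}, fun W hW => ⟨?_, ?_⟩⟩
    · rw [← hKP.kp2_source_ghost l, ← mul_assoc, sum_p_mul_p R (hW (by simp))]
    · rw [← hKP.kp2_ghost_range l, mul_assoc, p_mul_sum_p R (hW (by simp))]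

end KumjianPask

/-- For a row-finite `k`-graph without sources and a nonzero commutative ring `R`, the
Kumjian–Pask algebra has a multiplicative identity if and only if the vertex set is finite. -/
theorem mainTheorem5 {R : Type*} [CommRing R] [Nontrivial R] {k : ℕ} {Λ : Type*}
    [CategoryTheory.Category Λ] (G : KGraph k Λ) (hrow : G.RowFinite) (hsrc : G.NoSources) :
    (∃ e : KumjianPask R G, ∀ a : KumjianPask R G, e * a = a ∧ a * e = a) ↔ Finite Λ := by
  constructor
  · rintro ⟨e, he⟩
    obtain ⟨V, hV⟩ := KumjianPask.exists_local_unit R e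
    by_contra hinf
    have : Infinite Λ := not_finite_iff_infinite.1 hinf
    obtain ⟨a, ha⟩ := Infinite.exists_notMem_finset V
    apply KumjianPask.p_ne_zero R hsrc a
    -- `p_a = p_a e = p_a (∑ b ∈ V, p_b) e`, and the first product is zero since `a ∉ V`.
    rw [← (he (KumjianPask.p R G a)).2, ← (hV V subset_rfl).1, ← mul_assoc,
      KumjianPask.p_mul_sum_p_of_notMem R ha, zero_mul]
  · intro hfin
    have := Fintype.ofFinite Λ
    refine ⟨∑ b, KumjianPask.p R G b, fun a => ?_⟩
    obtain ⟨V, hV⟩ := KumjianPask.exists_local_unit R a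
    exact hV _ (Finset.subset_univ V)
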